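/- Let $D\ge 1$ and $N$ be natural numbers, and let $M_1,\dots,M_N\in\mathbb{C}^{D\times D}$ be nonzero Hermitian positive semidefinite matrices with $\bigcap_{n=1}^N\ker(M_n)=\{0\}$. Let $\mathcal D$ be the set of Hermitian positive semidefinite matrices in $\mathbb{C}^{D\times D}$ of unit trace, and let $$f(\rho)=\frac1N\sum_{n=1}^N-\log\operatorname{tr}(M_n\rho)\in(-\infty,+\infty],\qquad \rho\in\mathcal D,$$ with the convention $-\log 0=+\infty$. Where all $\operatorname{tr}(M_n\rho)$ are positive, put $$R(\rho)=-\nabla f(\rho)=\frac1N\sum_{n=1}^N\frac{M_n}{\operatorname{tr}(M_n\rho)}.$$ Let $\rho_1=I/D$ and, for $k\ge1$, $$\rho_{k+1}=\mathcal N\bigl(\exp(\log\rho_k+\log R(\rho_k))\bigr),$$ where $\exp$ and $\log$ are the matrix exponential and logarithm and $\mathcal N(A)=A/\operatorname{tr}(A)$. Let $\overline\rho_k=(\rho_1+\dots+\rho_k)/k$. Then: 1. the iteration is well defined: for every $k\ge1$, $\rho_k\in\mathcal D$ is positive definite, $\operatorname{tr}(M_n\rho_k)>0$ for all $n$, and $R(\rho_k)$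 is positive definite; 2. $f$ attains its minimum over $\mathcal D$, and the minimum is finite; 3. for every minimizer $\hat\rho$ of $f$ over $\mathcal D$ and every $k\ge1$, $$f(\overline\rho_k)-f(\hat\rho)\le\frac{\log D}{k};$$ in particular, for every $\varepsilon>0$, $f(\overline\rho_k)-f(\hat\rho)\le\varepsilon$ for every integer $k\ge1$ with $k\ge(1/\varepsilon)\log D$. -/

import Mathlib

open scoped ComplexOrder Matrix

noncomputable section

namespace QuantumTomography

variable {D N : ℕ}

/-- The set `𝒟` of density matrices: Hermitian positive semidefinite `D × D` complex matrices of
unit trace. -/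
def densityMatrices (D : ℕ) : Set (Matrix (Fin D) (Fin D) ℂ) :=
  {ρ | ρ.PosSemidef ∧ ρ.trace = 1}

/-- The number `tr (A B)`, which is real when `A` and `B` are Hermitian
(see `coe_trMul`), as a real number. -/
def trMul (A B : Matrix (Fin D) (Fin D) ℂ) : ℝ := (A * B).trace.re

theorem coe_trMul {A B : Matrix (Fin D) (Fin D) ℂ} (hA : A.IsHermitian) (hB : B.IsHermitian) :
    (trMul A B : ℂ) = (A * B).trace := by
  refine Complex.conj_eq_iff_re.mp ?_
  have h : (A * B).trace = star (A * B).trace := by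
    rw [← Matrix.trace_conjTranspose, Matrix.conjTranspose_mul, hA.eq, hB.eq, Matrix.trace_mul_comm]
  exact h.symm

/-- The extended-real-valued function `x ↦ -log x`, equal to `+∞` for `x ≤ 0`. -/
def negLog (x : ℝ) : EReal := if 0 < x then ((-Real.log x : ℝ) : EReal) else ⊤

/-- The negative log-likelihood `f ρ = (1 / N) ∑ₙ -log tr (Mₙ ρ)`, equal to `+∞` as soon as one of
the numbers `tr (Mₙ ρ)` vanishes. -/
def negLogLikelihood (M : Fin N → Matrix (Fin D) (Fin D) ℂ) (ρ : Matrix (Fin D) (Fin D) ℂ) :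
    EReal :=
  ((1 / N : ℝ) : EReal) * ∑ n, negLog (trMul (M n) ρ)

/-- The matrix `R ρ = (1 / N) ∑ₙ Mₙ / tr (Mₙ ρ)`. It is the negative gradient of `f` at `ρ`, for
the Hilbert-Schmidt inner product: see `hasDerivAt_negLogLikelihood`. -/
def R (M : Fin N → Matrix (Fin D) (Fin D) ℂ) (ρ : Matrix (Fin D) (Fin D) ℂ) :
    Matrix (Fin D) (Fin D) ℂ :=
  (1 / N : ℝ) • ∑ n, (trMul (M n) ρ)⁻¹ • M n

/-- The logarithm of a Hermitian positive definite matrix (`Real.log` applied to its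
eigenvalues). -/
def matLog (A : Matrix (Fin D) (Fin D) ℂ) : Matrix (Fin D) (Fin D) ℂ := cfc Real.log A

/-- The map `𝒩`, which scales a matrix of nonzero trace to unit trace. -/
def normalize (A : Matrix (Fin D) (Fin D) ℂ) : Matrix (Fin D) (Fin D) ℂ := A.trace⁻¹ • A

/-- One step of the algorithm: `ρ ↦ 𝒩 (exp (log ρ + log (R ρ)))`. -/
def step (M : Fin N → Matrix (Fin D) (Fin D) ℂ) (ρ : Matrix (Fin D) (Fin D) ℂ) :
    Matrix (Fin D) (Fin D) ℂ :=
  normalize (NormedSpace.exp (matLog ρ + matLog (R M ρ)))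

/-- `(ρ₁ + ⋯ + ρₖ) / k`. -/
def average (ρ : ℕ → Matrix (Fin D) (Fin D) ℂ) (k : ℕ) : Matrix (Fin D) (Fin D) ℂ :=
  (1 / k : ℝ) • ∑ i ∈ Finset.Icc 1 k, ρ i

theorem negLogLikelihood_eq (M : Fin N → Matrix (Fin D) (Fin D) ℂ)
    {ρ : Matrix (Fin D) (Fin D) ℂ} (hρ : ∀ n, 0 < trMul (M n) ρ) :
    negLogLikelihood M ρ = ((1 / N * ∑ n, -Real.log (trMul (M n) ρ) : ℝ) : EReal) := by
  have h : ∀ s : Finset (Fin N), ∑ n ∈ s, negLog (trMul (M n) ρ)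
      = ((∑ n ∈ s, -Real.log (trMul (M n) ρ) : ℝ) : EReal) := by
    intro s
    induction s using Finset.induction_on with
    | empty => simp
    | insert a s ha ih =>
      rw [Finset.sum_insert ha, Finset.sum_insert ha, ih, EReal.coe_add, negLog, if_pos (hρ a)]
  rw [negLogLikelihood, h, EReal.coe_mul]

/-- The derivative of `f` at `ρ` in the direction `δ` is `-tr (R ρ δ)`, that is, `R = -∇f`. -/
theorem hasDerivAt_negLogLikelihood (M : Fin N → Matrix (Fin D) (Fin D) ℂ)
    {ρ : Matrix (Fin D) (Fin D) ℂ} (hρ : ∀ n, 0 < trMul (M n) ρ)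
    (δ : Matrix (Fin D) (Fin D) ℂ) :
    HasDerivAt (fun t : ℝ => (negLogLikelihood M (ρ + t • δ)).toReal) (-trMul (R M ρ) δ) 0 := by
  have hlin : ∀ n (t : ℝ), trMul (M n) (ρ + t • δ) = trMul (M n) ρ + t * trMul (M n) δ := by
    intro n t
    simp [trMul, mul_add, Matrix.trace_add, Matrix.trace_smul]
  have hd : ∀ n, HasDerivAt (fun t : ℝ => trMul (M n) (ρ + t • δ)) (trMul (M n) δ) 0 := by
    intro n
    simp only [hlin]
    simpa using ((hasDerivAt_id (0 : ℝ)).mul_const (trMul (M n) δ)).const_add (trMul (M n) ρ)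
  have hev : ∀ᶠ t : ℝ in nhds 0, ∀ n, 0 < trMul (M n) (ρ + t • δ) := by
    rw [Filter.eventually_all]
    intro n
    exact (hd n).continuousAt.eventually (lt_mem_nhds (by simpa using hρ n))
  have hmain : HasDerivAt (fun t : ℝ => (1 / N : ℝ) * ∑ n, -Real.log (trMul (M n) (ρ + t • δ)))
      ((1 / N : ℝ) * ∑ n, -(trMul (M n) δ / trMul (M n) ρ)) 0 := by
    refine HasDerivAt.const_mul _ (HasDerivAt.fun_sum fun n _ => ?_)
    simpa using ((hd n).log (by simpa using (hρ n).ne')).fun_neg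
  have hval : (1 / N : ℝ) * ∑ n, -(trMul (M n) δ / trMul (M n) ρ) = -trMul (R M ρ) δ := by
    have hR : trMul (R M ρ) δ = (1 / N : ℝ) * ∑ n, (trMul (M n) ρ)⁻¹ * trMul (M n) δ := by
      simp only [trMul, R, Matrix.smul_mul, Finset.sum_mul, Matrix.trace_sum, Matrix.trace_smul,
        Complex.smul_re, Complex.re_sum, smul_eq_mul]
    rw [hR, Finset.sum_neg_distrib, mul_neg]
    simp only [div_eq_inv_mul]
  rw [← hval]
  refine hmain.congr_of_eventuallyEq ?_
  filter_upwards [hev] with t ht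
  rw [negLogLikelihood_eq M ht, EReal.toReal_coe]

end QuantumTomography

end

/-!
The argument is the one that proves the rate of Cover's method in the commutative case, where the
matrices are diagonal, with two matrix inequalities in place of scalar ones.

*Telescoping.* The Golden-Thompson inequality gives
`tr exp (log ρ + log (R ρ)) ≤ tr (ρ (R ρ)) = 1`, so that normalizing can only increase the
logarithm: `log ρₖ₊₁ ≥ log ρₖ + log (R ρₖ)` (`trMul_matLog_step`). Since `log ρ₁ = -log D` and
`log ρₖ₊₁ ≤ 0`, the sum of `tr (ρhat log (R ρᵢ))` over `i ≤ k` is at most `log D`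
(`sum_trMul_matLog_R_le`).

*Optimality gap.* A minimizer `ρhat` satisfies `R ρhat ≤ 1` and `tr (ρhat (R ρhat)) = 1`, so the
matrices `Bₙ = Mₙ / (N tr (Mₙ ρhat))` sum to the identity as far as `ρhat` can see. As
`R ρ = ∑ (tr (Mₙ ρhat) / tr (Mₙ ρ)) Bₙ`, Jensen's operator inequality for the logarithm gives
`f ρ - f ρhat ≤ tr (ρhat log (R ρ))` (`gap_le_trMul_matLog_R`). Summing over the iterates, and using
that `f` is convex, proves the rate.

Both matrix inequalities compare two finite sums `∑ a log x` and `∑ b log y`, and both follow from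
the comparison of `∑ a / (x + t)` with `∑ b / (y + t)` for all `t > 0`
(`sum_mul_log_le_of_resolvent`). The comparison of the resolvents is in each case a completed
square. Golden-Thompson is used in its variational form (`trMul_log_add_log_le`), which rests
on the fact that the relative entropy of two matrices is at least that of their diagonals in an
eigenbasis of the third one (`trMul_log_sub_log_le_sum_weight`).
-/

noncomputable section

namespace QuantumTomography

variable {D N : ℕ}

/-! ### Comparison of logarithms through resolvents -/

/-- If `∑ b / (y + t) ≤ ∑ a / (x + t)` for all `t > 0` and the total weights agree, then
`∑ a log x ≤ ∑ b log y`. This replaces the integral formula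
`log x = ∫ ((1 + t)⁻¹ - (x + t)⁻¹) dt`: the difference `∑ a log (x + t) - ∑ b log (y + t)` is
monotone in `t` and tends to `0` at infinity. -/
theorem sum_mul_log_le_of_resolvent {ι κ : Type*} [Fintype ι] [Fintype κ] {a x : ι → ℝ}
    {b y : κ → ℝ} (hx : ∀ i, 0 < x i) (hy : ∀ k, 0 < y k) (hab : ∑ i, a i = ∑ k, b k)
    (h : ∀ t : ℝ, 0 < t → ∑ k, b k / (y k + t) ≤ ∑ i, a i / (x i + t)) :
    ∑ i, a i * Real.log (x i) ≤ ∑ k, b k * Real.log (y k) := by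
  set F : ℝ → ℝ := fun t =>
    ∑ i, a i * Real.log (x i + t) - ∑ k, b k * Real.log (y k + t) with hF
  have hderiv : ∀ t : ℝ, 0 ≤ t →
      HasDerivAt F (∑ i, a i / (x i + t) - ∑ k, b k / (y k + t)) t := by
    intro t ht
    have key : ∀ c z : ℝ, 0 < z →
        HasDerivAt (fun s => c * Real.log (z + s)) (c / (z + t)) t := by
      intro c z hz
      have h1 : HasDerivAt (fun s : ℝ => z + s) 1 t := (hasDerivAt_id t).const_add z
      have h2 := (h1.log (by positivity)).const_mul c
      simpa [div_eq_mul_inv] using h2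
    exact (HasDerivAt.fun_sum fun i _ => key _ _ (hx i)).sub
      (HasDerivAt.fun_sum fun k _ => key _ _ (hy k))
  have hmono : MonotoneOn F (Set.Ici 0) := by
    refine monotoneOn_of_deriv_nonneg (convex_Ici 0)
      (fun t ht => (hderiv t ht).continuousAt.continuousWithinAt) ?_ ?_
    · intro t ht
      rw [interior_Ici] at ht
      exact (hderiv t (le_of_lt ht)).differentiableAt.differentiableWithinAt
    · intro t ht
      rw [interior_Ici] at ht
      rw [(hderiv t (le_of_lt ht)).deriv]
      linarith [h t ht]
  have hlim : Filter.Tendsto F Filter.atTop (nhds 0) := by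
    have key : ∀ z : ℝ, 0 < z →
        Filter.Tendsto (fun t => Real.log (z + t) - Real.log t) Filter.atTop (nhds 0) := by
      intro z hz
      have h1 : Filter.Tendsto (fun t : ℝ => Real.log (z / t + 1)) Filter.atTop (nhds 0) := by
        have h2 : Filter.Tendsto (fun t : ℝ => z / t + 1) Filter.atTop (nhds (0 + 1)) :=
          (Filter.tendsto_id.const_div_atTop z).add_const 1
        have h3 := h2.log (by norm_num)
        simpa using h3
      refine h1.congr' ?_
      filter_upwards [Filter.eventually_gt_atTop 0] with t ht
      rw [← Real.log_div (by positivity) ht.ne', add_div, div_self ht.ne']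
    have h1 : Filter.Tendsto (fun t => ∑ i, a i * (Real.log (x i + t) - Real.log t)
        - ∑ k, b k * (Real.log (y k + t) - Real.log t)) Filter.atTop
        (nhds (∑ i, a i * 0 - ∑ k, b k * 0)) :=
      (tendsto_finsetSum _ fun i _ => (key _ (hx i)).const_mul _).sub
        (tendsto_finsetSum _ fun k _ => (key _ (hy k)).const_mul _)
    simp only [mul_zero, Finset.sum_const_zero, sub_zero] at h1
    refine h1.congr fun t => ?_
    simp only [hF, mul_sub, Finset.sum_sub_distrib, ← Finset.sum_mul]
    rw [hab]
    ring
  have h0 : F 0 ≤ 0 := by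
    refine ge_of_tendsto hlim ?_
    filter_upwards [Filter.eventually_ge_atTop 0] with t ht
    exact hmono (Set.mem_Ici.mpr le_rfl) ht ht
  simpa [hF] using h0

/-! ### The trace form and matrices diagonal in a given basis -/

theorem trMul_comm (A B : Matrix (Fin D) (Fin D) ℂ) : trMul A B = trMul B A := by
  rw [trMul, trMul, Matrix.trace_mul_comm]

theorem trMul_add_right (A B C : Matrix (Fin D) (Fin D) ℂ) :
    trMul A (B + C) = trMul A B + trMul A C := by
  simp [trMul, mul_add]

theorem trMul_sub_right (A B C : Matrix (Fin D) (Fin D) ℂ) :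
    trMul A (B - C) = trMul A B - trMul A C := by
  simp [trMul, mul_sub]

theorem trMul_smul_right (c : ℝ) (A B : Matrix (Fin D) (Fin D) ℂ) :
    trMul A (c • B) = c * trMul A B := by
  simp [trMul]

theorem trMul_sum_right {ι : Type*} (s : Finset ι) (A : Matrix (Fin D) (Fin D) ℂ)
    (B : ι → Matrix (Fin D) (Fin D) ℂ) : trMul A (∑ i ∈ s, B i) = ∑ i ∈ s, trMul A (B i) := by
  simp [trMul, Finset.mul_sum, Matrix.trace_sum]

theorem trMul_one_right_of_mem {ρ : Matrix (Fin D) (Fin D) ℂ} (hρ : ρ ∈ densityMatrices D) :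
    trMul ρ 1 = 1 := by
  simp [trMul, hρ.2]

/-- The matrix `U diag(d) U*`, with real eigenvalues `d` and eigenvectors the columns of `U`. The
eigenvalues are indexed by the columns, so that a degenerate eigenvalue may be split. -/
def conjDiag (U : Matrix.unitaryGroup (Fin D) ℂ) (d : Fin D → ℝ) : Matrix (Fin D) (Fin D) ℂ :=
  (U : Matrix (Fin D) (Fin D) ℂ) * Matrix.diagonal (fun i => (d i : ℂ))
    * star (U : Matrix (Fin D) (Fin D) ℂ)

theorem conjDiag_mul (U : Matrix.unitaryGroup (Fin D) ℂ) (d e : Fin D → ℝ) :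
    conjDiag U d * conjDiag U e = conjDiag U (fun i => d i * e i) := by
  have hU : star (U : Matrix (Fin D) (Fin D) ℂ) * (U : Matrix (Fin D) (Fin D) ℂ) = 1 :=
    Unitary.coe_star_mul_self U
  calc conjDiag U d * conjDiag U e
      = (U : Matrix (Fin D) (Fin D) ℂ) * Matrix.diagonal (fun i => (d i : ℂ))
          * (star (U : Matrix (Fin D) (Fin D) ℂ) * (U : Matrix (Fin D) (Fin D) ℂ))
          * Matrix.diagonal (fun i => (e i : ℂ)) * star (U : Matrix (Fin D) (Fin D) ℂ) := by
        simp only [conjDiag, mul_assoc]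
    _ = _ := by
        rw [hU, mul_one, mul_assoc (U : Matrix (Fin D) (Fin D) ℂ), Matrix.diagonal_mul_diagonal,
          conjDiag]
        simp

theorem conjDiag_one (U : Matrix.unitaryGroup (Fin D) ℂ) : conjDiag U (fun _ => 1) = 1 := by
  have hU : (U : Matrix (Fin D) (Fin D) ℂ) * star (U : Matrix (Fin D) (Fin D) ℂ) = 1 :=
    Unitary.coe_mul_star_self U
  simp [conjDiag, hU]

theorem conjDiag_add (U : Matrix.unitaryGroup (Fin D) ℂ) (d e : Fin D → ℝ) :
    conjDiag U d + conjDiag U e = conjDiag U (fun i => d i + e i) := by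
  rw [conjDiag, conjDiag, ← add_mul, ← mul_add, Matrix.diagonal_add, conjDiag]
  simp

theorem conjDiag_const (U : Matrix.unitaryGroup (Fin D) ℂ) (t : ℝ) :
    conjDiag U (fun _ => t) = t • (1 : Matrix (Fin D) (Fin D) ℂ) := by
  have h : Matrix.diagonal (fun _ : Fin D => (t : ℂ)) = t • (1 : Matrix (Fin D) (Fin D) ℂ) := by
    rw [← Matrix.diagonal_one, ← Matrix.diagonal_smul]
    congr 1
    ext i
    simp
  have hU : (U : Matrix (Fin D) (Fin D) ℂ) * star (U : Matrix (Fin D) (Fin D) ℂ) = 1 :=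
    Unitary.coe_mul_star_self U
  rw [conjDiag, h, Matrix.mul_smul, Matrix.smul_mul, mul_one, hU]

theorem conjDiag_isHermitian (U : Matrix.unitaryGroup (Fin D) ℂ) (d : Fin D → ℝ) :
    (conjDiag U d).IsHermitian := by
  rw [Matrix.IsHermitian, conjDiag, Matrix.star_eq_conjTranspose, Matrix.conjTranspose_mul,
    Matrix.conjTranspose_mul, Matrix.conjTranspose_conjTranspose, Matrix.diagonal_conjTranspose,
    mul_assoc]
  congr 3
  ext i
  simp

theorem cfc_eq_conjDiag {A : Matrix (Fin D) (Fin D) ℂ} (hA : A.IsHermitian) (f : ℝ → ℝ) :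
    cfc f A = conjDiag hA.eigenvectorUnitary (fun i => f (hA.eigenvalues i)) := by
  rw [hA.cfc_eq]
  rfl

theorem eq_conjDiag {A : Matrix (Fin D) (Fin D) ℂ} (hA : A.IsHermitian) :
    A = conjDiag hA.eigenvectorUnitary hA.eigenvalues := by
  conv_lhs => rw [hA.spectral_theorem]
  rfl

theorem conjDiag_posDef (U : Matrix.unitaryGroup (Fin D) ℂ) {d : Fin D → ℝ} (hd : ∀ i, 0 < d i) :
    (conjDiag U d).PosDef := by
  rw [conjDiag, Matrix.IsUnit.posDef_star_right_conjugate_iff (Unitary.isUnit_coe (U := U))]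
  simpa using hd

theorem conjDiag_posSemidef (U : Matrix.unitaryGroup (Fin D) ℂ) {d : Fin D → ℝ}
    (hd : ∀ i, 0 ≤ d i) : (conjDiag U d).PosSemidef := by
  rw [conjDiag, Matrix.IsUnit.posSemidef_star_right_conjugate_iff (Unitary.isUnit_coe (U := U)),
    Matrix.posSemidef_diagonal_iff]
  simpa using hd

theorem trace_conjDiag (U : Matrix.unitaryGroup (Fin D) ℂ) (d : Fin D → ℝ) :
    (conjDiag U d).trace = ((∑ k, d k : ℝ) : ℂ) := by
  have hU : star (U : Matrix (Fin D) (Fin D) ℂ) * (U : Matrix (Fin D) (Fin D) ℂ) = 1 :=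
    Unitary.coe_star_mul_self U
  rw [conjDiag, Matrix.trace_mul_comm, ← mul_assoc, hU, one_mul, Matrix.trace_diagonal,
    Complex.ofReal_sum]

theorem sum_eigenvalues_eq_one {ρ : Matrix (Fin D) (Fin D) ℂ} (hρ : ρ ∈ densityMatrices D) :
    ∑ k, hρ.1.isHermitian.eigenvalues k = 1 := by
  have h := trace_conjDiag hρ.1.isHermitian.eigenvectorUnitary hρ.1.isHermitian.eigenvalues
  rw [← eq_conjDiag] at h
  exact_mod_cast h.symm.trans hρ.2

/-- The weight of the matrix `X` on the `k`-th column of `U`: the diagonal entry of `U* X U`. -/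
def weight (U : Matrix.unitaryGroup (Fin D) ℂ) (X : Matrix (Fin D) (Fin D) ℂ) (k : Fin D) : ℝ :=
  ((star (U : Matrix (Fin D) (Fin D) ℂ) * X * (U : Matrix (Fin D) (Fin D) ℂ)) k k).re

theorem trMul_conjDiag (U : Matrix.unitaryGroup (Fin D) ℂ) (X : Matrix (Fin D) (Fin D) ℂ)
    (d : Fin D → ℝ) : trMul X (conjDiag U d) = ∑ k, d k * weight U X k := by
  have h : (X * conjDiag U d).trace = (Matrix.diagonal (fun i => (d i : ℂ))
      * (star (U : Matrix (Fin D) (Fin D) ℂ) * X * (U : Matrix (Fin D) (Fin D) ℂ))).trace := by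
    rw [conjDiag, Matrix.trace_mul_comm X, mul_assoc, mul_assoc, Matrix.trace_mul_comm, mul_assoc]
  rw [trMul, h, Matrix.trace, Complex.re_sum]
  simp [Matrix.diagonal_mul, weight]

theorem sum_weight (U : Matrix.unitaryGroup (Fin D) ℂ) (X : Matrix (Fin D) (Fin D) ℂ) :
    ∑ k, weight U X k = trMul X 1 := by
  rw [← conjDiag_one U, trMul_conjDiag]
  simp

theorem weight_nonneg (U : Matrix.unitaryGroup (Fin D) ℂ) {X : Matrix (Fin D) (Fin D) ℂ}
    (hX : X.PosSemidef) (k : Fin D) : 0 ≤ weight U X k :=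
  (Complex.nonneg_iff.mp (hX.conjTranspose_mul_mul_same
    (U : Matrix (Fin D) (Fin D) ℂ)).diag_nonneg).1

theorem weight_pos (U : Matrix.unitaryGroup (Fin D) ℂ) {X : Matrix (Fin D) (Fin D) ℂ}
    (hX : X.PosDef) (k : Fin D) : 0 < weight U X k := by
  have h : (star (U : Matrix (Fin D) (Fin D) ℂ) * X * (U : Matrix (Fin D) (Fin D) ℂ)).PosDef :=
    (Matrix.IsUnit.posDef_star_left_conjugate_iff (Unitary.isUnit_coe (U := U))).mpr hX
  exact (Complex.pos_iff.mp h.diag_pos).1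

theorem trMul_nonneg {A B : Matrix (Fin D) (Fin D) ℂ} (hA : A.PosSemidef) (hB : B.PosSemidef) :
    0 ≤ trMul A B := by
  rw [eq_conjDiag hB.isHermitian, trMul_conjDiag]
  exact Finset.sum_nonneg fun k _ => mul_nonneg (hB.eigenvalues_nonneg k) (weight_nonneg _ hA k)

theorem trMul_pos {A B : Matrix (Fin D) (Fin D) ℂ} (hA : A.PosSemidef) (hA0 : A ≠ 0)
    (hB : B.PosDef) : 0 < trMul A B := by
  have h1 : 0 < trMul A 1 := by
    have h2 : 0 < A.trace := lt_of_le_of_ne hA.trace_nonneg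
      fun h => hA0 (hA.trace_eq_zero_iff.mp h.symm)
    simpa [trMul] using (Complex.pos_iff.mp h2).1
  rw [← sum_weight hB.isHermitian.eigenvectorUnitary] at h1
  rw [eq_conjDiag hB.isHermitian, trMul_conjDiag]
  obtain ⟨k, -, hk⟩ := Finset.exists_lt_of_sum_lt (s := Finset.univ)
    (f := fun _ => (0 : ℝ)) (by simpa using h1)
  exact Finset.sum_pos' (fun k _ => mul_nonneg (hB.eigenvalues_pos k).le (weight_nonneg _ hA k))
    ⟨k, Finset.mem_univ k, mul_pos (hB.eigenvalues_pos k) hk⟩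

/-- The trace `tr (A C B E*)` in the eigenbases of `A = U diag(s) U*` and `B = V diag(r) V*`. -/
theorem trMul_conjDiag_conj (U V : Matrix.unitaryGroup (Fin D) ℂ) (s r : Fin D → ℝ)
    (C E : Matrix (Fin D) (Fin D) ℂ) :
    trMul (conjDiag U s) (C * conjDiag V r * star E) =
      ∑ i, ∑ j, s i * r j *
        ((star (U : Matrix (Fin D) (Fin D) ℂ) * C * (V : Matrix (Fin D) (Fin D) ℂ)) i j
          * star ((star (U : Matrix (Fin D) (Fin D) ℂ) * E
            * (V : Matrix (Fin D) (Fin D) ℂ)) i j)).re := by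
  rw [trMul_comm, trMul_conjDiag]
  refine Finset.sum_congr rfl fun i _ => ?_
  have h : star (U : Matrix (Fin D) (Fin D) ℂ) * (C * conjDiag V r * star E)
      * (U : Matrix (Fin D) (Fin D) ℂ)
      = (star (U : Matrix (Fin D) (Fin D) ℂ) * C * (V : Matrix (Fin D) (Fin D) ℂ))
        * Matrix.diagonal (fun i => (r i : ℂ))
        * star (star (U : Matrix (Fin D) (Fin D) ℂ) * E * (V : Matrix (Fin D) (Fin D) ℂ)) := by
    simp only [conjDiag, star_mul, star_star, mul_assoc]
  rw [weight, h, Matrix.mul_apply, Complex.re_sum, Finset.mul_sum]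
  refine Finset.sum_congr rfl fun j _ => ?_
  rw [Matrix.mul_diagonal, Matrix.star_apply, mul_right_comm, mul_comm _ (r j : ℂ),
    Complex.re_ofReal_mul, ← mul_assoc (s i)]

/-! ### Jensen's operator inequality for the logarithm -/

/-- Expanding `0 ≤ tr ρ (1 - c W) B (1 - c W)`. -/
theorem trMul_mul_add_trMul_mul_le {ρ B W : Matrix (Fin D) (Fin D) ℂ} (hρ : ρ.PosSemidef)
    (hB : B.PosSemidef) (hW : W.IsHermitian) {c : ℝ} (hc : 0 < c) :
    trMul ρ (B * W) + trMul ρ (W * B) - c * trMul ρ (W * B * W) ≤ trMul ρ B / c := by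
  have hH : (1 - c • W).IsHermitian := by
    refine Matrix.isHermitian_one.sub ?_
    rw [Matrix.IsHermitian, Matrix.conjTranspose_smul, hW.eq, star_trivial]
  have h1 : ((1 - c • W) * B * (1 - c • W)).PosSemidef := by
    have := hB.mul_mul_conjTranspose_same (1 - c • W)
    rwa [hH.eq] at this
  have h2 := trMul_nonneg hρ h1
  have h3 : (1 - c • W) * B * (1 - c • W)
      = B - c • (B * W) - c • (W * B) + (c * c) • (W * B * W) := by
    simp only [sub_mul, mul_sub, one_mul, mul_one, Matrix.smul_mul, Matrix.mul_smul, smul_smul]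
    abel
  rw [h3, trMul_add_right, trMul_sub_right, trMul_sub_right, trMul_smul_right, trMul_smul_right,
    trMul_smul_right] at h2
  rw [le_div_iff₀ hc]
  linarith

/-- Jensen's operator inequality for the logarithm in the state `ρ`. The effects `B n` need only
sum to the identity in the state `ρ`: the remainder `1 - ∑ B n` is positive semidefinite and has
weight zero. -/
theorem sum_mul_log_le_trMul_matLog {ι : Type*} [Fintype ι] {ρ A : Matrix (Fin D) (Fin D) ℂ}
    (hρ : ρ ∈ densityMatrices D) {B : ι → Matrix (Fin D) (Fin D) ℂ} (hB : ∀ n, (B n).PosSemidef)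
    (hB1 : (1 - ∑ n, B n).PosSemidef) (hρB : ∑ n, trMul ρ (B n) = 1) {x : ι → ℝ}
    (hx : ∀ n, 0 < x n) (hA : A.PosDef) (hAB : A = ∑ n, x n • B n) :
    ∑ n, trMul ρ (B n) * Real.log (x n) ≤ trMul ρ (matLog A) := by
  set U := hA.isHermitian.eigenvectorUnitary
  set l := hA.isHermitian.eigenvalues
  have hl : ∀ k, 0 < l k := hA.eigenvalues_pos
  have hAl : A = conjDiag U l := eq_conjDiag hA.isHermitian
  have h1 := trMul_one_right_of_mem hρ
  rw [matLog, cfc_eq_conjDiag hA.isHermitian, trMul_conjDiag]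
  simp only [mul_comm (Real.log _)]
  refine sum_mul_log_le_of_resolvent hx hl (by rw [hρB, sum_weight, h1]) fun t ht => ?_
  -- `W` is the resolvent `(A + t)⁻¹`.
  set W := conjDiag U (fun k => (l k + t)⁻¹) with hWdef
  have hW : W.IsHermitian := conjDiag_isHermitian _ _
  have hT : ∑ k, weight U ρ k / (l k + t) = trMul ρ W := by
    rw [hWdef, trMul_conjDiag]
    exact Finset.sum_congr rfl fun k _ => by rw [div_eq_inv_mul]
  have hWW : W * A * W + t • (W * W) = W := by
    have h2 : A * W + t • W = 1 := by
      rw [← conjDiag_one U]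
      have : t • W = conjDiag U (fun _ => t) * W := by
        rw [conjDiag_const, Matrix.smul_mul, one_mul]
      rw [this, hAl, ← add_mul, conjDiag_add, hWdef, conjDiag_mul]
      congr 1
      ext k
      exact mul_inv_cancel₀ (by linarith [hl k])
    calc W * A * W + t • (W * W) = W * (A * W + t • W) := by
          rw [mul_add, mul_assoc, Matrix.mul_smul]
      _ = W := by rw [h2, mul_one]
  have hn : ∀ n, trMul ρ (B n * W) + trMul ρ (W * B n) - (x n + t) * trMul ρ (W * B n * W)
      ≤ trMul ρ (B n) / (x n + t) := fun n =>
    trMul_mul_add_trMul_mul_le hρ.1 (hB n) hW (by linarith [hx n])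
  have h0 := trMul_mul_add_trMul_mul_le hρ.1 hB1 hW ht
  have hsum := Finset.sum_le_sum fun n (_ : n ∈ Finset.univ) => hn n
  have e1 : ∑ n, (trMul ρ (B n * W) + trMul ρ (W * B n) - (x n + t) * trMul ρ (W * B n * W))
      = trMul ρ ((∑ n, B n) * W) + trMul ρ (W * ∑ n, B n) - trMul ρ (W * A * W)
        - t * trMul ρ (W * (∑ n, B n) * W) := by
    rw [hAB]
    simp only [Finset.sum_mul, Finset.mul_sum, trMul_sum_right, Matrix.mul_smul, Matrix.smul_mul,
      trMul_smul_right, Finset.sum_sub_distrib, Finset.sum_add_distrib, add_mul]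
    ring
  have e2 : trMul ρ (1 - ∑ n, B n) = 0 := by
    rw [trMul_sub_right, trMul_sum_right, hρB, h1, sub_self]
  have e3 := congrArg (trMul ρ) hWW
  rw [trMul_add_right, trMul_smul_right] at e3
  rw [e2, zero_div] at h0
  simp only [sub_mul, mul_sub, one_mul, mul_one, trMul_sub_right] at h0
  rw [hT]
  linarith

/-! ### The Golden-Thompson inequality in variational form -/

/-- The spectral form of monotonicity of the relative entropy under a measurement in the
orthonormal basis `V`. -/
theorem trMul_log_sub_log_le_sum_weight {σ ρ : Matrix (Fin D) (Fin D) ℂ} (hσ : σ.PosDef)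
    (hρ : ρ.PosDef) (V : Matrix.unitaryGroup (Fin D) ℂ) :
    trMul σ (matLog ρ) - trMul σ (matLog σ) ≤
      ∑ k, weight V σ k * Real.log (weight V ρ k / weight V σ k) := by
  set S := hσ.isHermitian.eigenvectorUnitary
  set s := hσ.isHermitian.eigenvalues
  set P := hρ.isHermitian.eigenvectorUnitary
  set r := hρ.isHermitian.eigenvalues
  have hs0 : ∀ k, 0 < s k := hσ.eigenvalues_pos
  have hr0 : ∀ k, 0 < r k := hρ.eigenvalues_pos
  have hσs : σ = conjDiag S s := eq_conjDiag hσ.isHermitian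
  have hρr : ρ = conjDiag P r := eq_conjDiag hρ.isHermitian
  have hp0 : ∀ k, 0 < weight V σ k := weight_pos V hσ
  have hq0 : ∀ k, 0 < weight V ρ k := weight_pos V hρ
  set m : Fin D → Fin D → ℂ := fun i j =>
    (star (S : Matrix (Fin D) (Fin D) ℂ) * (1 : Matrix (Fin D) (Fin D) ℂ)
      * (P : Matrix (Fin D) (Fin D) ℂ)) i j with hm
  have key : ∀ d e : Fin D → ℝ, trMul (conjDiag S d) (conjDiag P e)
      = ∑ ij : Fin D × Fin D, d ij.1 * e ij.2 * Complex.normSq (m ij.1 ij.2) := by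
    intro d e
    have := trMul_conjDiag_conj S P d e 1 1
    rw [one_mul, star_one, mul_one] at this
    rw [this, Fintype.sum_prod_type]
    simp only [hm, Complex.star_def, Complex.mul_conj, Complex.ofReal_re]
  have hlog : trMul σ (matLog ρ) - trMul σ (matLog σ)
      = ∑ ij : Fin D × Fin D, s ij.1 * Complex.normSq (m ij.1 ij.2)
          * Real.log (r ij.2 / s ij.1) := by
    have h1 : trMul σ (matLog σ)
        = trMul (conjDiag S fun i => s i * Real.log (s i)) (conjDiag P fun _ => 1) := by
      rw [conjDiag_one, trMul, trMul, mul_one, ← conjDiag_mul, ← hσs, matLog,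
        cfc_eq_conjDiag hσ.isHermitian]
    rw [h1, matLog, cfc_eq_conjDiag hρ.isHermitian]
    nth_rw 1 [hσs]
    rw [key, key, ← Finset.sum_sub_distrib]
    refine Finset.sum_congr rfl fun ij _ => ?_
    rw [Real.log_div (hr0 _).ne' (hs0 _).ne']
    ring
  rw [hlog]
  refine sum_mul_log_le_of_resolvent (fun ij => div_pos (hr0 _) (hs0 _))
    (fun k => div_pos (hq0 k) (hp0 k)) ?_ fun t ht => ?_
  · have h1 := key s fun _ => 1
    rw [← hσs, conjDiag_one] at h1
    rw [sum_weight, h1]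
    simp only [mul_one]
  -- `C` maximises `2 tr (σ C) - tr (ρ C²) - t tr (σ C²)` among the matrices diagonal in `V`.
  set c : Fin D → ℝ := fun k => (weight V ρ k / weight V σ k + t)⁻¹ with hc
  set C := conjDiag V c with hC
  have hCs : star C = C := conjDiag_isHermitian V c
  set n : Fin D → Fin D → ℂ := fun i j =>
    (star (S : Matrix (Fin D) (Fin D) ℂ) * C * (P : Matrix (Fin D) (Fin D) ℂ)) i j with hn
  have hCC : ∀ X, trMul X (C * C) = ∑ k, c k * c k * weight V X k := fun X => by
    rw [hC, conjDiag_mul, trMul_conjDiag]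
  have e1 : ∑ ij : Fin D × Fin D, s ij.1 * (n ij.1 ij.2 * star (m ij.1 ij.2)).re
      = ∑ k, c k * weight V σ k := by
    have := trMul_conjDiag_conj S P s (fun _ => 1) C 1
    rw [conjDiag_one, star_one, mul_one, mul_one, ← hσs, hC, trMul_conjDiag] at this
    rw [this, Fintype.sum_prod_type]
    simp only [mul_one, hn, hm, hC]
  have e2 : ∑ ij : Fin D × Fin D, r ij.2 * Complex.normSq (n ij.1 ij.2)
      = ∑ k, c k * c k * weight V ρ k := by
    have := trMul_conjDiag_conj S P (fun _ => 1) r C C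
    rw [conjDiag_one, ← hρr, hCs] at this
    have h2 : trMul 1 (C * ρ * C) = trMul ρ (C * C) := by
      rw [trMul, trMul, one_mul, mul_assoc, Matrix.trace_mul_comm, mul_assoc]
    rw [← hCC, ← h2, this, Fintype.sum_prod_type]
    simp only [one_mul, hn, Complex.star_def, Complex.mul_conj, Complex.ofReal_re]
  have e3 : ∑ ij : Fin D × Fin D, s ij.1 * Complex.normSq (n ij.1 ij.2)
      = ∑ k, c k * c k * weight V σ k := by
    have := trMul_conjDiag_conj S P s (fun _ => 1) C C
    rw [conjDiag_one, ← hσs, hCs, mul_one] at this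
    rw [← hCC, this, Fintype.sum_prod_type]
    simp only [mul_one, hn, Complex.star_def, Complex.mul_conj, Complex.ofReal_re]
  have hentry : ∀ ij : Fin D × Fin D,
      2 * (s ij.1 * (n ij.1 ij.2 * star (m ij.1 ij.2)).re)
        - r ij.2 * Complex.normSq (n ij.1 ij.2) - t * (s ij.1 * Complex.normSq (n ij.1 ij.2))
      ≤ s ij.1 * Complex.normSq (m ij.1 ij.2) / (r ij.2 / s ij.1 + t) := by
    intro ij
    have hsi := hs0 ij.1
    set L := r ij.2 / s ij.1 + t with hL
    have hL0 : 0 < L := add_pos (div_pos (hr0 _) hsi) ht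
    have hLs : r ij.2 = s ij.1 * (L - t) := by
      rw [hL]
      field_simp
      ring
    rw [le_div_iff₀ hL0, hLs]
    have h1 : 0 ≤ Complex.normSq (m ij.1 ij.2 - L * n ij.1 ij.2) := Complex.normSq_nonneg _
    have h2 : Complex.normSq (m ij.1 ij.2 - L * n ij.1 ij.2)
        = Complex.normSq (m ij.1 ij.2) - 2 * L * (n ij.1 ij.2 * star (m ij.1 ij.2)).re
          + L * L * Complex.normSq (n ij.1 ij.2) := by
      simp only [Complex.normSq_apply, Complex.sub_re, Complex.sub_im, Complex.mul_re,
        Complex.mul_im, Complex.ofReal_re, Complex.ofReal_im, Complex.star_def, Complex.conj_re,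
        Complex.conj_im]
      ring
    have h3 := mul_nonneg hsi.le (h2 ▸ h1)
    linarith
  have hsum := Finset.sum_le_sum fun ij (_ : ij ∈ Finset.univ) => hentry ij
  rw [Finset.sum_sub_distrib, Finset.sum_sub_distrib, ← Finset.mul_sum, ← Finset.mul_sum, e1, e2,
    e3] at hsum
  refine le_trans (le_of_eq ?_) hsum
  rw [Finset.mul_sum, Finset.mul_sum, ← Finset.sum_sub_distrib, ← Finset.sum_sub_distrib]
  refine Finset.sum_congr rfl fun k _ => ?_
  have h1 : c k * (weight V ρ k + t * weight V σ k) = weight V σ k := by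
    have := hp0 k
    have := hq0 k
    simp only [hc]
    field_simp
  have h2 : weight V σ k / (weight V ρ k / weight V σ k + t) = c k * weight V σ k := by
    rw [div_eq_inv_mul]
  rw [h2]
  linear_combination (c k) * h1

/-- The Golden-Thompson inequality in the form given to it by the variational principle
`log tr exp H = max_σ (tr σ H - tr σ log σ)`. -/
theorem trMul_log_add_log_le {σ ρ A : Matrix (Fin D) (Fin D) ℂ} (hσ : σ.PosDef)
    (hσ1 : trMul σ 1 = 1) (hρ : ρ.PosDef) (hA : A.PosDef) :
    trMul σ (matLog ρ) + trMul σ (matLog A) - trMul σ (matLog σ) ≤ Real.log (trMul ρ A) := by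
  set V := hA.isHermitian.eigenvectorUnitary
  set l := hA.isHermitian.eigenvalues
  have hl : ∀ k, 0 < l k := hA.eigenvalues_pos
  have hp0 : ∀ k, 0 < weight V σ k := weight_pos V hσ
  have hq0 : ∀ k, 0 < weight V ρ k := weight_pos V hρ
  have h1 := trMul_log_sub_log_le_sum_weight hσ hρ V
  have h2 : trMul σ (matLog A) = ∑ k, Real.log (l k) * weight V σ k := by
    rw [matLog, cfc_eq_conjDiag hA.isHermitian, trMul_conjDiag]
  have h3 : trMul ρ A = ∑ k, l k * weight V ρ k := by
    conv_lhs => rw [eq_conjDiag hA.isHermitian]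
    rw [trMul_conjDiag]
  have h4 := strictConcaveOn_log_Ioi.concaveOn.le_map_sum (t := Finset.univ)
    (w := fun k => weight V σ k) (p := fun k => l k * weight V ρ k / weight V σ k)
    (fun k _ => (hp0 k).le) (by rw [sum_weight, hσ1])
    (fun k _ => div_pos (mul_pos (hl k) (hq0 k)) (hp0 k))
  have h5 : ∑ k, weight V σ k • (l k * weight V ρ k / weight V σ k) = trMul ρ A := by
    rw [h3]
    exact Finset.sum_congr rfl fun k _ => by
      rw [smul_eq_mul, mul_div_cancel₀ _ (hp0 k).ne']
  have h6 : ∑ k, weight V σ k • Real.log (l k * weight V ρ k / weight V σ k)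
      = ∑ k, weight V σ k * Real.log (weight V ρ k / weight V σ k)
        + ∑ k, Real.log (l k) * weight V σ k := by
    rw [← Finset.sum_add_distrib]
    refine Finset.sum_congr rfl fun k _ => ?_
    rw [smul_eq_mul, mul_div_assoc, Real.log_mul (hl k).ne' (div_pos (hq0 k) (hp0 k)).ne']
    ring
  rw [h5, h6] at h4
  linarith

/-! ### One step of the iteration -/

theorem pos_of_iInf_ker_eq_bot (hD : 0 < D) {M : Fin N → Matrix (Fin D) (Fin D) ℂ}
    (hker : ⨅ n, LinearMap.ker (M n).mulVecLin = ⊥) : 0 < N := by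
  rcases Nat.eq_zero_or_pos N with rfl | h
  · have : NeZero D := ⟨hD.ne'⟩
    rw [iInf_of_empty] at hker
    exact absurd hker top_ne_bot
  · exact h

theorem R_posSemidef {M : Fin N → Matrix (Fin D) (Fin D) ℂ} (hM : ∀ n, (M n).PosSemidef)
    {ρ : Matrix (Fin D) (Fin D) ℂ} (hpos : ∀ n, 0 < trMul (M n) ρ) : (R M ρ).PosSemidef :=
  (Matrix.posSemidef_sum _ fun n _ => (hM n).smul (inv_pos.mpr (hpos n)).le).smul (by positivity)

theorem R_posDef (hN : 0 < N) {M : Fin N → Matrix (Fin D) (Fin D) ℂ}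
    (hM : ∀ n, (M n).PosSemidef) (hker : ⨅ n, LinearMap.ker (M n).mulVecLin = ⊥)
    {ρ : Matrix (Fin D) (Fin D) ℂ} (hpos : ∀ n, 0 < trMul (M n) ρ) : (R M ρ).PosDef := by
  have hR := R_posSemidef hM hpos
  refine Matrix.PosDef.of_dotProduct_mulVec_pos hR.isHermitian fun x hx => ?_
  refine lt_of_le_of_ne (hR.dotProduct_mulVec_nonneg x) fun h => hx ?_
  have hterm : ∀ n, ((trMul (M n) ρ)⁻¹ • M n).PosSemidef := fun n =>
    (hM n).smul (inv_pos.mpr (hpos n)).le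
  have h1 : star x ⬝ᵥ (R M ρ).mulVec x
      = (1 / N : ℝ) • ∑ n, star x ⬝ᵥ ((trMul (M n) ρ)⁻¹ • M n).mulVec x := by
    rw [R, Matrix.smul_mulVec, dotProduct_smul, Matrix.sum_mulVec, dotProduct_sum]
  have hN' : (1 / N : ℝ) ≠ 0 := by positivity
  rw [h1, eq_comm, smul_eq_zero_iff_right hN', Finset.sum_eq_zero_iff_of_nonneg
    fun n _ => (hterm n).dotProduct_mulVec_nonneg x] at h
  have h2 : x ∈ ⨅ n, LinearMap.ker (M n).mulVecLin := by
    rw [Submodule.mem_iInf]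
    intro n
    have h3 := (hterm n).dotProduct_mulVec_zero_iff x |>.mp (h n (Finset.mem_univ n))
    rw [Matrix.smul_mulVec, smul_eq_zero_iff_right (inv_pos.mpr (hpos n)).ne'] at h3
    simpa using h3
  rw [hker] at h2
  simpa using h2

theorem trMul_R_right (M : Fin N → Matrix (Fin D) (Fin D) ℂ) (ρ σ : Matrix (Fin D) (Fin D) ℂ) :
    trMul σ (R M ρ) = 1 / N * ∑ n, (trMul (M n) ρ)⁻¹ * trMul (M n) σ := by
  rw [R, trMul_smul_right, trMul_sum_right]
  simp only [trMul_smul_right]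
  simp only [trMul_comm σ]

theorem trMul_R_self (hN : 0 < N) {M : Fin N → Matrix (Fin D) (Fin D) ℂ}
    {ρ : Matrix (Fin D) (Fin D) ℂ} (hpos : ∀ n, 0 < trMul (M n) ρ) : trMul ρ (R M ρ) = 1 := by
  rw [trMul_R_right, Finset.sum_congr rfl fun n _ => inv_mul_cancel₀ (hpos n).ne']
  simp [hN.ne']

theorem matLog_isHermitian (A : Matrix (Fin D) (Fin D) ℂ) : (matLog A).IsHermitian :=
  cfc_predicate Real.log A

theorem exp_eq_cfc {H : Matrix (Fin D) (Fin D) ℂ} (hH : H.IsHermitian) :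
    NormedSpace.exp H = cfc Real.exp H := by
  set U := hH.eigenvectorUnitary
  have hU : (U : Matrix (Fin D) (Fin D) ℂ)⁻¹ = star (U : Matrix (Fin D) (Fin D) ℂ) :=
    Matrix.inv_eq_right_inv (Unitary.coe_mul_star_self U)
  rw [cfc_eq_conjDiag hH]
  conv_lhs => rw [eq_conjDiag hH]
  rw [conjDiag, conjDiag, ← hU, Matrix.exp_conj _ _ (Unitary.isUnit_coe (U := U)),
    Matrix.exp_diagonal]
  congr 3
  ext i
  rw [Pi.coe_exp, ← Complex.exp_eq_exp_ℂ, Complex.ofReal_exp]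

theorem exp_posDef {H : Matrix (Fin D) (Fin D) ℂ} (hH : H.IsHermitian) :
    (NormedSpace.exp H).PosDef := by
  rw [exp_eq_cfc hH, cfc_eq_conjDiag hH]
  exact conjDiag_posDef _ fun i => Real.exp_pos _

theorem trMul_exp_one_pos (hD : 0 < D) {H : Matrix (Fin D) (Fin D) ℂ} (hH : H.IsHermitian) :
    0 < trMul (NormedSpace.exp H) 1 := by
  have : Nonempty (Fin D) := ⟨⟨0, hD⟩⟩
  simpa [trMul] using (Complex.pos_iff.mp (exp_posDef hH).trace_pos).1

theorem normalize_exp {H : Matrix (Fin D) (Fin D) ℂ} (hH : H.IsHermitian) :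
    normalize (NormedSpace.exp H)
      = (trMul (NormedSpace.exp H) 1)⁻¹ • NormedSpace.exp H := by
  have h : (NormedSpace.exp H).trace = ((trMul (NormedSpace.exp H) 1 : ℝ) : ℂ) := by
    rw [coe_trMul (exp_posDef hH).isHermitian Matrix.isHermitian_one, mul_one]
  rw [normalize, h, ← Complex.ofReal_inv]
  ext i j
  simp

theorem normalize_exp_posDef (hD : 0 < D) {H : Matrix (Fin D) (Fin D) ℂ} (hH : H.IsHermitian) :
    (normalize (NormedSpace.exp H)).PosDef := by
  rw [normalize_exp hH]
  exact (exp_posDef hH).smul (inv_pos.mpr (trMul_exp_one_pos hD hH))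

theorem normalize_exp_mem (hD : 0 < D) {H : Matrix (Fin D) (Fin D) ℂ} (hH : H.IsHermitian) :
    normalize (NormedSpace.exp H) ∈ densityMatrices D := by
  refine ⟨(normalize_exp_posDef hD hH).posSemidef, ?_⟩
  have : Nonempty (Fin D) := ⟨⟨0, hD⟩⟩
  rw [normalize, Matrix.trace_smul, smul_eq_mul, inv_mul_cancel₀ (exp_posDef hH).trace_pos.ne']

theorem matLog_normalize_exp (hD : 0 < D) {H : Matrix (Fin D) (Fin D) ℂ} (hH : H.IsHermitian) :
    matLog (normalize (NormedSpace.exp H))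
      = H - Real.log (trMul (NormedSpace.exp H) 1) • (1 : Matrix (Fin D) (Fin D) ℂ) := by
  have hZ := trMul_exp_one_pos hD hH
  rw [normalize_exp hH]
  set Z := trMul (NormedSpace.exp H) 1
  have h1 : Z⁻¹ • NormedSpace.exp H = cfc (fun x => Z⁻¹ * Real.exp x) H := by
    rw [exp_eq_cfc hH, cfc_const_mul Z⁻¹ Real.exp H (Matrix.finite_real_spectrum.continuousOn _)]
  rw [h1, matLog, ← cfc_comp' Real.log (fun x => Z⁻¹ * Real.exp x) H
    ((Matrix.finite_real_spectrum.image _).continuousOn _)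
    (Matrix.finite_real_spectrum.continuousOn _) hH.isSelfAdjoint, cfc_eq_conjDiag hH,
    sub_eq_add_neg, ← neg_smul, ← conjDiag_const hH.eigenvectorUnitary]
  have h2 := conjDiag_add hH.eigenvectorUnitary hH.eigenvalues fun _ => -Real.log Z
  rw [← eq_conjDiag hH] at h2
  rw [h2]
  congr 1
  ext i
  rw [Real.log_mul (inv_pos.mpr hZ).ne' (Real.exp_pos _).ne', Real.log_inv, Real.log_exp]
  ring

/-- By the Golden-Thompson inequality `tr exp (log ρ + log R) ≤ tr (ρ R) = 1`, the normalization
increases the logarithm. -/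
theorem log_trMul_exp_le_zero (hD : 0 < D) (hN : 0 < N) {M : Fin N → Matrix (Fin D) (Fin D) ℂ}
    {ρ : Matrix (Fin D) (Fin D) ℂ} (hρ : ρ.PosDef) (hpos : ∀ n, 0 < trMul (M n) ρ)
    (hR : (R M ρ).PosDef) :
    Real.log (trMul (NormedSpace.exp (matLog ρ + matLog (R M ρ))) 1) ≤ 0 := by
  have hH : (matLog ρ + matLog (R M ρ)).IsHermitian :=
    (matLog_isHermitian _).add (matLog_isHermitian _)
  have h1 := trMul_one_right_of_mem (normalize_exp_mem hD hH)
  have h2 := trMul_log_add_log_le (normalize_exp_posDef hD hH) h1 hρ hR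
  rw [trMul_R_self hN hpos, Real.log_one, matLog_normalize_exp hD hH, trMul_sub_right,
    trMul_smul_right, h1, trMul_add_right] at h2
  linarith

/-- The inequality `log ρ + log (R ρ) ≤ log (step ρ)` in the state `σ`. -/
theorem trMul_matLog_step (hD : 0 < D) (hN : 0 < N) {M : Fin N → Matrix (Fin D) (Fin D) ℂ}
    {ρ : Matrix (Fin D) (Fin D) ℂ} (hρ : ρ.PosDef) (hpos : ∀ n, 0 < trMul (M n) ρ)
    (hR : (R M ρ).PosDef) {σ : Matrix (Fin D) (Fin D) ℂ} (hσ : σ ∈ densityMatrices D) :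
    trMul σ (matLog ρ) + trMul σ (matLog (R M ρ)) ≤ trMul σ (matLog (step M ρ)) := by
  have hH : (matLog ρ + matLog (R M ρ)).IsHermitian :=
    (matLog_isHermitian _).add (matLog_isHermitian _)
  rw [step, matLog_normalize_exp hD hH, trMul_sub_right, trMul_add_right, trMul_smul_right,
    trMul_one_right_of_mem hσ]
  linarith [log_trMul_exp_le_zero hD hN hρ hpos hR]

theorem trMul_matLog_le_zero {ρ σ : Matrix (Fin D) (Fin D) ℂ} (hρ : ρ ∈ densityMatrices D)
    (hσ : σ ∈ densityMatrices D) : trMul σ (matLog ρ) ≤ 0 := by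
  have hH := hρ.1.isHermitian
  have h0 := hρ.1.eigenvalues_nonneg
  rw [matLog, cfc_eq_conjDiag hH, trMul_conjDiag]
  refine Finset.sum_nonpos fun k _ => mul_nonpos_of_nonpos_of_nonneg
    (Real.log_nonpos (h0 k) ?_) (weight_nonneg _ hσ.1 k)
  rw [← sum_eigenvalues_eq_one hρ]
  exact Finset.single_le_sum (fun k _ => h0 k) (Finset.mem_univ k)

theorem maximallyMixed_posDef (hD : 0 < D) :
    ((1 / D : ℝ) • (1 : Matrix (Fin D) (Fin D) ℂ)).PosDef :=
  Matrix.PosDef.one.smul (by positivity)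

theorem maximallyMixed_mem (hD : 0 < D) :
    (1 / D : ℝ) • (1 : Matrix (Fin D) (Fin D) ℂ) ∈ densityMatrices D := by
  refine ⟨(maximallyMixed_posDef hD).posSemidef, ?_⟩
  have : (D : ℂ) ≠ 0 := by exact_mod_cast hD.ne'
  simp [Matrix.trace_smul, this]

theorem matLog_maximallyMixed :
    matLog ((1 / D : ℝ) • (1 : Matrix (Fin D) (Fin D) ℂ))
      = (-Real.log D) • (1 : Matrix (Fin D) (Fin D) ℂ) := by
  have h := cfc_algebraMap (A := Matrix (Fin D) (Fin D) ℂ) (1 / D : ℝ) Real.log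
  rw [Algebra.algebraMap_eq_smul_one, Algebra.algebraMap_eq_smul_one] at h
  rw [matLog, h]
  simp

/-! ### Existence of a minimizer -/

theorem norm_apply_le_one {ρ : Matrix (Fin D) (Fin D) ℂ} (hρ : ρ ∈ densityMatrices D)
    (i j : Fin D) : ‖ρ i j‖ ≤ 1 := by
  have h0 := hρ.1.eigenvalues_nonneg
  have hU := entry_norm_bound_of_unitary hρ.1.isHermitian.eigenvectorUnitary.2
  rw [eq_conjDiag hρ.1.isHermitian, conjDiag, Matrix.mul_apply, ← sum_eigenvalues_eq_one hρ]
  refine norm_sum_le_of_le _ fun k _ => ?_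
  rw [Matrix.mul_diagonal, Matrix.star_apply, norm_mul, norm_mul, norm_star, Complex.norm_real,
    Real.norm_of_nonneg (h0 k)]
  calc _ ≤ 1 * hρ.1.isHermitian.eigenvalues k * 1 :=
        mul_le_mul (mul_le_mul_of_nonneg_right (hU _ _) (h0 k)) (hU _ _) (norm_nonneg _)
          (by linarith [h0 k])
    _ = _ := by ring

theorem isCompact_densityMatrices : IsCompact (densityMatrices D) := by
  have hK : IsCompact (Set.univ.pi fun _ : Fin D => Set.univ.pi fun _ : Fin D =>
      Metric.closedBall (0 : ℂ) 1) :=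
    isCompact_univ_pi fun _ => isCompact_univ_pi fun _ => isCompact_closedBall _ _
  refine IsCompact.of_isClosed_subset (X := Matrix (Fin D) (Fin D) ℂ) hK ?_
    fun ρ hρ i _ j _ => by simpa using norm_apply_le_one hρ i j
  have h : densityMatrices D = {ρ | ρᴴ = ρ} ∩ (⋂ x : Fin D → ℂ, {ρ | 0 ≤ star x ⬝ᵥ ρ.mulVec x})
      ∩ {ρ | ρ.trace = 1} := by
    ext ρ
    simp only [densityMatrices, Matrix.posSemidef_iff_dotProduct_mulVec, Set.mem_ofPred_eq,
      Set.mem_inter_iff, Set.mem_iInter, Matrix.IsHermitian]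
  rw [h]
  refine ((isClosed_eq (by fun_prop) continuous_id).inter (isClosed_iInter fun x =>
    isClosed_le continuous_const (by fun_prop))).inter (isClosed_eq (by fun_prop) continuous_const)

theorem negLog_ne_bot (x : ℝ) : negLog x ≠ ⊥ := by
  rw [negLog]
  split_ifs
  · exact EReal.coe_ne_bot _
  · exact top_ne_bot

theorem negLogLikelihood_eq_top (M : Fin N → Matrix (Fin D) (Fin D) ℂ)
    {ρ : Matrix (Fin D) (Fin D) ℂ} (h : ∃ n, trMul (M n) ρ ≤ 0) : negLogLikelihood M ρ = ⊤ := by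
  obtain ⟨n, hn⟩ := h
  have hN : (0 : ℝ) < N := by exact_mod_cast Fin.pos n
  have hs : ∀ s : Finset (Fin N), ∑ m ∈ s, negLog (trMul (M m) ρ) ≠ ⊥ := by
    intro s
    induction s using Finset.induction_on with
    | empty => simp
    | insert a s ha ih =>
      rw [Finset.sum_insert ha]
      exact EReal.add_ne_bot_iff.mpr ⟨negLog_ne_bot _, ih⟩
  rw [negLogLikelihood, ← Finset.add_sum_erase _ _ (Finset.mem_univ n), negLog,
    if_neg hn.not_gt, EReal.top_add_of_ne_bot (hs _), EReal.coe_mul_top_of_pos (by positivity)]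

theorem continuous_trMul (A : Matrix (Fin D) (Fin D) ℂ) :
    Continuous fun ρ : Matrix (Fin D) (Fin D) ℂ => trMul A ρ := by
  unfold trMul
  fun_prop

/-- A minimizer of `f` is a maximizer of the likelihood `∏ tr (Mₙ ρ)`, a continuous function on a
compact set, whose maximum is positive since it is positive at a full-rank state. -/
theorem exists_isMinOn_negLogLikelihood {M : Fin N → Matrix (Fin D) (Fin D) ℂ}
    (hM : ∀ n, (M n).PosSemidef) {ρ₀ : Matrix (Fin D) (Fin D) ℂ} (hρ₀ : ρ₀ ∈ densityMatrices D)
    (hpos : ∀ n, 0 < trMul (M n) ρ₀) :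
    ∃ ρhat ∈ densityMatrices D, IsMinOn (negLogLikelihood M) (densityMatrices D) ρhat := by
  obtain ⟨ρhat, hmem, hmax⟩ := isCompact_densityMatrices.exists_isMaxOn ⟨ρ₀, hρ₀⟩
    (f := fun ρ => ∏ n, trMul (M n) ρ)
    (continuous_finsetProd _ fun n _ => continuous_trMul (M n)).continuousOn
  have hprod : 0 < ∏ n, trMul (M n) ρhat :=
    lt_of_lt_of_le (Finset.prod_pos fun n _ => hpos n) (hmax hρ₀)
  have hhat : ∀ n, 0 < trMul (M n) ρhat := fun n =>
    lt_of_le_of_ne (trMul_nonneg (hM n) hmem.1)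
      fun h => hprod.ne' (Finset.prod_eq_zero (Finset.mem_univ n) h.symm)
  refine ⟨ρhat, hmem, fun ρ hρ => ?_⟩
  rw [Set.mem_ofPred_eq]
  by_cases h : ∀ n, 0 < trMul (M n) ρ
  · rw [negLogLikelihood_eq M h, negLogLikelihood_eq M hhat, EReal.coe_le_coe_iff,
      Finset.sum_neg_distrib, Finset.sum_neg_distrib, ← Real.log_prod fun n _ => (h n).ne',
      ← Real.log_prod fun n _ => (hhat n).ne']
    have h1 := Real.log_le_log (Finset.prod_pos fun n _ => h n) (hmax hρ)
    exact mul_le_mul_of_nonneg_left (neg_le_neg h1) (by positivity)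
  · push Not at h
    rw [negLogLikelihood_eq_top M h]
    exact le_top

/-! ### First-order optimality -/

/-- At a minimizer the directional derivative of `f` towards any other state is nonnegative. -/
theorem trMul_R_le_one (hN : 0 < N) {M : Fin N → Matrix (Fin D) (Fin D) ℂ}
    {ρ σ : Matrix (Fin D) (Fin D) ℂ} (hρ : ρ ∈ densityMatrices D)
    (hmin : IsMinOn (negLogLikelihood M) (densityMatrices D) ρ) (hpos : ∀ n, 0 < trMul (M n) ρ)
    (hσ : σ ∈ densityMatrices D) : trMul σ (R M ρ) ≤ 1 := by
  have hd := (hasDerivAt_negLogLikelihood M hpos (σ - ρ)).tendsto_slope_zero_right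
  have hmem : ∀ t : ℝ, 0 ≤ t → t ≤ 1 → ρ + t • (σ - ρ) ∈ densityMatrices D := by
    intro t h0 h1
    have h2 : ρ + t • (σ - ρ) = (1 - t) • ρ + t • σ := by
      rw [smul_sub, sub_smul, one_smul]
      abel
    rw [h2]
    refine ⟨(hρ.1.smul (sub_nonneg.mpr h1)).add (hσ.1.smul h0), ?_⟩
    rw [Matrix.trace_add, Matrix.trace_smul, Matrix.trace_smul, hρ.2, hσ.2, ← add_smul]
    simp
  have hev : ∀ᶠ t : ℝ in nhdsWithin 0 (Set.Ioi 0), ∀ n, 0 < trMul (M n) (ρ + t • (σ - ρ)) := by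
    rw [Filter.eventually_all]
    intro n
    have hc : Continuous fun t : ℝ => trMul (M n) (ρ + t • (σ - ρ)) :=
      (continuous_trMul (M n)).comp (by fun_prop)
    exact nhdsWithin_le_nhds (hc.continuousAt.eventually (lt_mem_nhds (by simpa using hpos n)))
  have hge : 0 ≤ -trMul (R M ρ) (σ - ρ) := by
    refine ge_of_tendsto hd ?_
    filter_upwards [hev, self_mem_nhdsWithin,
      nhdsWithin_le_nhds (Iic_mem_nhds (zero_lt_one (α := ℝ)))] with t ht h0 h1
    have h0' : 0 < t := h0
    have h2 := hmin (hmem t h0'.le h1)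
    rw [Set.mem_ofPred_eq, negLogLikelihood_eq M ht, negLogLikelihood_eq M hpos,
      EReal.coe_le_coe_iff] at h2
    rw [smul_eq_mul, zero_add, zero_smul, add_zero, negLogLikelihood_eq M ht,
      negLogLikelihood_eq M hpos, EReal.toReal_coe, EReal.toReal_coe]
    exact mul_nonneg (inv_pos.mpr h0').le (sub_nonneg.mpr h2)
  rw [trMul_sub_right, trMul_comm _ ρ, trMul_R_self hN hpos, trMul_comm] at hge
  linarith

theorem one_sub_R_posSemidef (hN : 0 < N) {M : Fin N → Matrix (Fin D) (Fin D) ℂ}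
    (hM : ∀ n, (M n).PosSemidef) {ρ : Matrix (Fin D) (Fin D) ℂ} (hρ : ρ ∈ densityMatrices D)
    (hmin : IsMinOn (negLogLikelihood M) (densityMatrices D) ρ)
    (hpos : ∀ n, 0 < trMul (M n) ρ) : (1 - R M ρ).PosSemidef := by
  have hR := (R_posSemidef hM hpos).isHermitian
  set U := hR.eigenvectorUnitary
  set l := hR.eigenvalues
  have hl : ∀ k, l k ≤ 1 := by
    intro k
    -- The state here is the projection onto the `k`-th eigenvector of `R`.
    have h1 := trMul_R_le_one (σ := conjDiag U (Pi.single k 1)) hN hρ hmin hpos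
      ⟨conjDiag_posSemidef U fun i => by
        rw [Pi.single_apply]
        positivity, by
        rw [trace_conjDiag]
        simp⟩
    rw [eq_conjDiag hR, trMul, conjDiag_mul, trace_conjDiag, Complex.ofReal_re] at h1
    simpa [Pi.single_apply] using h1
  have h2 := conjDiag_add U (fun k => 1 - l k) l
  simp only [sub_add_cancel] at h2
  rw [conjDiag_one, ← eq_conjDiag hR] at h2
  rw [← h2, add_sub_cancel_right]
  exact conjDiag_posSemidef U fun k => sub_nonneg.mpr (hl k)

/-! ### The bound on the averaged iterates -/

/-- The optimality gap of a single iterate is bounded by `tr (ρhat log R)`: optimality of `ρhat`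
makes the matrices `Mₙ / (N tr (Mₙ ρhat))` effects that sum to the identity in the state `ρhat`. -/
theorem gap_le_trMul_matLog_R (hN : 0 < N) {M : Fin N → Matrix (Fin D) (Fin D) ℂ}
    (hM : ∀ n, (M n).PosSemidef) {ρ ρhat : Matrix (Fin D) (Fin D) ℂ}
    (hpos : ∀ n, 0 < trMul (M n) ρ) (hR : (R M ρ).PosDef) (hhat : ρhat ∈ densityMatrices D)
    (hmin : IsMinOn (negLogLikelihood M) (densityMatrices D) ρhat)
    (hpos' : ∀ n, 0 < trMul (M n) ρhat) :
    1 / N * ∑ n, -Real.log (trMul (M n) ρ) - 1 / N * ∑ n, -Real.log (trMul (M n) ρhat)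
      ≤ trMul ρhat (matLog (R M ρ)) := by
  have hN' : (N : ℝ) ≠ 0 := by exact_mod_cast hN.ne'
  set B : Fin N → Matrix (Fin D) (Fin D) ℂ :=
    fun n => (1 / N : ℝ) • (trMul (M n) ρhat)⁻¹ • M n with hB
  have hsum : ∑ n, B n = R M ρhat := by rw [R, Finset.smul_sum]
  have htr : ∀ n, trMul ρhat (B n) = 1 / N := by
    intro n
    rw [hB, trMul_smul_right, trMul_smul_right, trMul_comm ρhat,
      inv_mul_cancel₀ (hpos' n).ne', mul_one]
  have h := sum_mul_log_le_trMul_matLog hhat (B := B)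
    (x := fun n => trMul (M n) ρhat / trMul (M n) ρ)
    (fun n => ((hM n).smul (inv_pos.mpr (hpos' n)).le).smul (by positivity))
    (by rw [hsum]; exact one_sub_R_posSemidef hN hM hhat hmin hpos')
    (by simp [htr, hN']) (fun n => div_pos (hpos' n) (hpos n)) hR ?_
  · refine le_trans (le_of_eq ?_) h
    rw [← mul_sub, ← Finset.sum_sub_distrib, Finset.mul_sum]
    refine Finset.sum_congr rfl fun n _ => ?_
    rw [htr, Real.log_div (hpos' n).ne' (hpos n).ne']
    ring
  · rw [R, Finset.smul_sum]
    refine Finset.sum_congr rfl fun n _ => ?_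
    rw [hB, smul_smul, smul_smul, smul_smul]
    congr 1
    have := (hpos n).ne'
    have := (hpos' n).ne'
    field_simp

theorem trMul_average (A : Matrix (Fin D) (Fin D) ℂ) (ρ : ℕ → Matrix (Fin D) (Fin D) ℂ) (k : ℕ) :
    trMul A (average ρ k) = 1 / k * ∑ i ∈ Finset.Icc 1 k, trMul A (ρ i) := by
  rw [average, trMul_smul_right, trMul_sum_right]

/-- Convexity of `x ↦ -log x` at the average of the iterates. -/
theorem neg_log_trMul_average_le {A : Matrix (Fin D) (Fin D) ℂ}
    {ρ : ℕ → Matrix (Fin D) (Fin D) ℂ} (hpos : ∀ i, 1 ≤ i → 0 < trMul A (ρ i)) {k : ℕ}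
    (hk : 1 ≤ k) :
    0 < trMul A (average ρ k) ∧
      -Real.log (trMul A (average ρ k))
        ≤ 1 / k * ∑ i ∈ Finset.Icc 1 k, -Real.log (trMul A (ρ i)) := by
  have hk' : (0 : ℝ) < k := by exact_mod_cast hk
  rw [trMul_average]
  refine ⟨mul_pos (by positivity) (Finset.sum_pos (fun i hi => hpos i (Finset.mem_Icc.mp hi).1)
    ⟨1, Finset.mem_Icc.mpr ⟨le_rfl, hk⟩⟩), ?_⟩
  have h := strictConcaveOn_log_Ioi.concaveOn.le_map_sum (t := Finset.Icc 1 k)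
    (w := fun _ => (1 / k : ℝ)) (p := fun i => trMul A (ρ i)) (fun _ _ => by positivity)
    (by simp [hk'.ne']) (fun i hi => hpos i (Finset.mem_Icc.mp hi).1)
  simp only [smul_eq_mul, ← Finset.mul_sum] at h
  rw [Finset.sum_neg_distrib]
  linarith

/-- The telescoped form of `trMul_matLog_step`, from `log ρ₁ = -log D` to `log ρₖ₊₁ ≤ 0`. -/
theorem sum_trMul_matLog_R_le (hD : 0 < D) (hN : 0 < N) {M : Fin N → Matrix (Fin D) (Fin D) ℂ}
    {ρ : ℕ → Matrix (Fin D) (Fin D) ℂ}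
    (hρ1 : ρ 1 = (1 / D : ℝ) • (1 : Matrix (Fin D) (Fin D) ℂ))
    (hρ : ∀ k : ℕ, 1 ≤ k → ρ (k + 1) = step M (ρ k))
    (hwell : ∀ k : ℕ, 1 ≤ k → ρ k ∈ densityMatrices D ∧ (ρ k).PosDef ∧
      (∀ n, 0 < trMul (M n) (ρ k)) ∧ (R M (ρ k)).PosDef)
    {σ : Matrix (Fin D) (Fin D) ℂ} (hσ : σ ∈ densityMatrices D) (k : ℕ) :
    ∑ i ∈ Finset.Icc 1 k, trMul σ (matLog (R M (ρ i))) ≤ Real.log D := by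
  have h : ∀ k : ℕ, ∑ i ∈ Finset.Icc 1 k, trMul σ (matLog (R M (ρ i))) - Real.log D
      ≤ trMul σ (matLog (ρ (k + 1))) := by
    intro k
    induction k with
    | zero =>
      rw [zero_add, hρ1, matLog_maximallyMixed, trMul_smul_right, trMul_one_right_of_mem hσ]
      simp
    | succ k ih =>
      obtain ⟨-, hdef, hpos, hR⟩ := hwell (k + 1) (by omega)
      have := trMul_matLog_step hD hN hdef hpos hR hσ
      rw [Finset.sum_Icc_succ_top (by omega), hρ (k + 1) (by omega)]
      linarith
  have h1 := trMul_matLog_le_zero (hwell (k + 1) (by omega)).1 hσ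
  linarith [h k]

end QuantumTomography

end

theorem theorem1 {D N : ℕ} (hD : 0 < D)
    (M : Fin N → Matrix (Fin D) (Fin D) ℂ)
    (hM : ∀ n, (M n).PosSemidef) (hM0 : ∀ n, M n ≠ 0)
    (hker : ⨅ n, LinearMap.ker (M n).mulVecLin = ⊥)
    (ρ : ℕ → Matrix (Fin D) (Fin D) ℂ)
    (hρ1 : ρ 1 = (1 / D : ℝ) • (1 : Matrix (Fin D) (Fin D) ℂ))
    (hρ : ∀ k : ℕ, 1 ≤ k → ρ (k + 1) = QuantumTomography.step M (ρ k)) :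
    -- the iteration is well defined
    (∀ k : ℕ, 1 ≤ k →
      ρ k ∈ QuantumTomography.densityMatrices D ∧ (ρ k).PosDef ∧
      (∀ n, 0 < QuantumTomography.trMul (M n) (ρ k)) ∧
      (QuantumTomography.R M (ρ k)).PosDef) ∧
    -- the minimum exists
    (∃ ρhat ∈ QuantumTomography.densityMatrices D,
      IsMinOn (QuantumTomography.negLogLikelihood M) (QuantumTomography.densityMatrices D) ρhat) ∧
    -- the bounds hold for every minimizer, and the minimum is finite
    ∀ ρhat ∈ QuantumTomography.densityMatrices D,
      IsMinOn (QuantumTomography.negLogLikelihood M) (QuantumTomography.densityMatrices D) ρhat →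
      QuantumTomography.negLogLikelihood M ρhat ≠ ⊤ ∧
      (∀ k : ℕ, 1 ≤ k →
        QuantumTomography.negLogLikelihood M (QuantumTomography.average ρ k)
          - QuantumTomography.negLogLikelihood M ρhat ≤ ((Real.log D / k : ℝ) : EReal)) ∧
      (∀ ε : ℝ, 0 < ε → ∀ k : ℕ, 1 ≤ k → 1 / ε * Real.log D ≤ k →
        QuantumTomography.negLogLikelihood M (QuantumTomography.average ρ k)
          - QuantumTomography.negLogLikelihood M ρhat ≤ (ε : EReal)) := by
  open QuantumTomography in
  have hN := pos_of_iInf_ker_eq_bot hD hker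
  have hwell : ∀ k : ℕ, 1 ≤ k → ρ k ∈ densityMatrices D ∧ (ρ k).PosDef ∧
      (∀ n, 0 < trMul (M n) (ρ k)) ∧ (R M (ρ k)).PosDef := by
    have hrest : ∀ k, (ρ k).PosDef →
        (∀ n, 0 < trMul (M n) (ρ k)) ∧ (R M (ρ k)).PosDef := fun k hk =>
      have hpos := fun n => trMul_pos (hM n) (hM0 n) hk
      ⟨hpos, R_posDef hN hM hker hpos⟩
    intro k hk
    rcases hk.eq_or_lt with rfl | hk
    · have h1 := maximallyMixed_posDef hD
      rw [← hρ1] at h1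
      exact ⟨hρ1 ▸ maximallyMixed_mem hD, h1, hrest 1 h1⟩
    · obtain ⟨j, rfl⟩ : ∃ j, k = j + 1 := ⟨k - 1, by omega⟩
      have hH : (matLog (ρ j) + matLog (R M (ρ j))).IsHermitian :=
        (matLog_isHermitian _).add (matLog_isHermitian _)
      have h1 := normalize_exp_posDef hD hH
      rw [← step, ← hρ j (by omega)] at h1
      exact ⟨hρ j (by omega) ▸ normalize_exp_mem hD hH, h1, hrest _ h1⟩
  refine ⟨hwell, exists_isMinOn_negLogLikelihood hM (hwell 1 le_rfl).1 (hwell 1 le_rfl).2.2.1,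
    fun ρhat hhat hmin => ?_⟩
  have htop : negLogLikelihood M ρhat ≠ ⊤ := by
    refine ne_top_of_le_ne_top ?_ (hmin (hwell 1 le_rfl).1)
    rw [negLogLikelihood_eq M (hwell 1 le_rfl).2.2.1]
    exact EReal.coe_ne_top _
  have hpos' : ∀ n, 0 < trMul (M n) ρhat := by
    by_contra! h
    exact htop (negLogLikelihood_eq_top M h)
  have hbound : ∀ k : ℕ, 1 ≤ k → negLogLikelihood M (average ρ k) - negLogLikelihood M ρhat
      ≤ ((Real.log D / k : ℝ) : EReal) := by
    intro k hk
    have hk' : (0 : ℝ) < k := by exact_mod_cast hk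
    have havg := fun n => neg_log_trMul_average_le (A := M n)
      (fun i hi => (hwell i hi).2.2.1 n) hk
    rw [negLogLikelihood_eq M fun n => (havg n).1, negLogLikelihood_eq M hpos', ← EReal.coe_sub,
      EReal.coe_le_coe_iff]
    set c : ℝ := 1 / N * ∑ n, -Real.log (trMul (M n) ρhat)
    have h1 : 1 / N * ∑ n, -Real.log (trMul (M n) (average ρ k))
        ≤ 1 / k * ∑ i ∈ Finset.Icc 1 k, 1 / N * ∑ n, -Real.log (trMul (M n) (ρ i)) := by
      calc _ ≤ (1 / N : ℝ) * ∑ n, 1 / k * ∑ i ∈ Finset.Icc 1 k, -Real.log (trMul (M n) (ρ i)) :=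
            mul_le_mul_of_nonneg_left (Finset.sum_le_sum fun n _ => (havg n).2) (by positivity)
        _ = _ := by
            rw [← Finset.mul_sum, ← Finset.mul_sum, Finset.sum_comm]
            ring
    have h2 : ∑ i ∈ Finset.Icc 1 k, (1 / N * ∑ n, -Real.log (trMul (M n) (ρ i)) - c)
        ≤ Real.log D := by
      refine le_trans (Finset.sum_le_sum fun i hi => ?_)
        (sum_trMul_matLog_R_le hD hN hρ1 hρ hwell hhat k)
      obtain ⟨-, -, hpos, hR⟩ := hwell i (Finset.mem_Icc.mp hi).1
      exact gap_le_trMul_matLog_R hN hM hpos hR hhat hmin hpos'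
    rw [Finset.sum_sub_distrib, Finset.sum_const, Nat.card_Icc, nsmul_eq_mul,
      Nat.add_sub_cancel] at h2
    rw [le_div_iff₀ hk']
    rw [one_div_mul_eq_div (k : ℝ), le_div_iff₀ hk'] at h1
    linarith
  refine ⟨htop, hbound, fun ε hε k hk hkε => (hbound k hk).trans ?_⟩
  have hk' : (0 : ℝ) < k := by exact_mod_cast hk
  rw [EReal.coe_le_coe_iff, div_le_iff₀ hk']
  rw [one_div_mul_eq_div, div_le_iff₀ hε] at hkε
  linarith
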